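/- **Setting.** Operators are bounded and linear, Banach spaces and Banach lattices are real, and $E^{*}$ denotes the dual of $E$, with closed unit balls $B_E$, $B_{E^*}$. Let $p\in[1,\infty]$ and let $p^{*}$ be the conjugate exponent, $\frac1p+\frac1{p^{*}}=1$. For a finite or infinite sequence $(u_n)$ in a Banach space $E$ put $$\|(u_n)\|_p=\Big(\sum_n\|u_n\|^p\Big)^{1/p},\qquad \|(u_n)\|_p^w=\sup_{u^*\in B_{E^*}}\Big(\sum_n|\langle u^*,u_n\rangle|^p\Big)^{1/p}$$ (suprema over $n$ when $p=\infty$), and let $\ell_p(E)$, $\ell_p^w(E)$ be the spaces of sequences for which these are finite. The space $E$ has the approximation property (AP) if for every compact $K\subset E$ and every $\epsilon>0$ there is a finite rank operator $R:E\to E$ with $\|Ru-u\|<\epsilon$ for all $u\in K$. * An operator $U:E\to F$ between Banach spaces is *nuclear* if $U=\sum_{j=1}^\infty u_j^*\otimes v_j$ (i.e. $Ux=\sum_j\langle u_j^*,x\rangle v_j$ for all $x$) with $(u_j^*)\in\ell_1(E^*)$ and $(v_j)\in\ell_\infty^w(F)$; $\nu(U)$ is the infimum of $\|(u_j^*)\|_1\,\|(v_j)\|_\infty^w$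 over all such representations. * An operator $T:X\to E$ from a Banach lattice $X$ to a Banach space $E$ is *positively $p$-nuclear* if $T=\sum_{j=1}^\infty x_j^*\otimes u_j$ (i.e. $Tx=\sum_j\langle x_j^*,x\rangle u_j$ for all $x$) with $x_j^*\ge 0$, $(x_j^*)\in\ell^w_{p^*}(X^*)$ and $(u_j)\in\ell_p(E)$; $\widetilde\nu^p(T)$ is the infimum of $\|(x_j^*)\|^w_{p^*}\,\|(u_j)\|_p$ over all such representations. The set of these operators is $\widetilde{\mathcal N}^p(X,E)$. * For $r\in[1,\infty]$, an operator $S:E\to X$ is *positive $r$-majorizing* if there is $C>0$ with $$\big\|(\langle x_j^*,Su_j\rangle)_{j=1}^n\big\|_r\le C\,\|(x_j^*)_{j=1}^n\|_r^w$$ for all $n$, all $u_1,\dots,u_n\in B_E$ and all positive $x_1^*,\dots,x_n^*\in X^*$. The set of these operators is $\Upsilon_r(E,X)$, and $\|S\|_{\Upsilon_r}$ is the infimum of such $C$. * $\mathcal U_*^p(E,X)$ is the set of operators $S:E\to X$ such that $TS$ is nuclear for every $T\in\widetilde{\mathcal N}^p(X,E)$, and $\zeta^p(S)=\sup\{\nu(TS):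 T\in\widetilde{\mathcal N}^p(X,E),\ \widetilde\nu^p(T)\le1\}$ is the norm of the map $T\mapsto TS$ from $(\widetilde{\mathcal N}^p(X,E),\widetilde\nu^p)$ to the nuclear operators $(\mathcal N(E,E),\nu)$. **Theorem.** Let $p\in[1,\infty]$ and let $E$ be a Banach space with the AP. Then for every Banach lattice $X$, $$\Upsilon_{p^*}(E,X)=\mathcal U_*^p(E,X),$$ and $\|S\|_{\Upsilon_{p^*}}=\zeta^p(S)$ for every $S$ in this space. -/

import Mathlib

open scoped ENNReal NNReal

noncomputable section

namespace PosMajorizing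

/-- The `ℓ_p`-norm `‖(u_i)_i‖_p` of a family of vectors, as an extended non-negative real:
`(∑ ‖u_i‖ ^ p) ^ (1 / p)` for finite `p`, and `sup ‖u_i‖` for `p = ∞`.
The family lies in `ℓ_p(E)` exactly when this is finite. -/
def seqNorm {ι E : Type*} [NormedAddCommGroup E] (p : ℝ≥0∞) (u : ι → E) : ℝ≥0∞ :=
  if p = ∞ then ⨆ i, ‖u i‖ₑ else (∑' i, ‖u i‖ₑ ^ p.toReal) ^ (1 / p.toReal)

/-- The weak `ℓ_p`-norm `‖(u_i)_i‖_p^w`: the supremum, over the functionals `φ` in the closed unit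
ball of the dual, of the `ℓ_p`-norm of `(φ(u_i))_i`.
The family lies in `ℓ_p^w(E)` exactly when this is finite. -/
def weakSeqNorm {ι E : Type*} [NormedAddCommGroup E] [NormedSpace ℝ E]
    (p : ℝ≥0∞) (u : ι → E) : ℝ≥0∞ :=
  ⨆ (φ : StrongDual ℝ E) (_ : ‖φ‖ ≤ 1), seqNorm p (fun i => φ (u i))

/-- The approximation property: the identity can be approximated by finite rank operators,
uniformly on every compact set. -/
def HasAP (E : Type*) [NormedAddCommGroup E] [NormedSpace ℝ E] : Prop :=
  ∀ ε : ℝ, 0 < ε → ∀ K : Set E, IsCompact K →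
    ∃ R : E →L[ℝ] E, FiniteDimensional ℝ (LinearMap.range (R : E →ₗ[ℝ] E)) ∧
      ∀ u ∈ K, ‖R u - u‖ < ε

/-- `f` belongs to the positive cone of the dual Banach lattice. -/
def IsPosFunctional {X : Type*} [NormedAddCommGroup X] [NormedSpace ℝ X] [Lattice X]
    (f : StrongDual ℝ X) : Prop :=
  ∀ x : X, 0 ≤ x → 0 ≤ f x

section Nuclear

variable {E F : Type*} [NormedAddCommGroup E] [NormedSpace ℝ E]
  [NormedAddCommGroup F] [NormedSpace ℝ F]

/-- `U = ∑ u*_j ⊗ v_j` is a (1-)nuclear representation: `(u*_j) ∈ ℓ_1(E*)`,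
`(v_j) ∈ ℓ_∞^w(F)`. -/
def IsNuclearRep (U : E →L[ℝ] F) (a : ℕ → StrongDual ℝ E) (v : ℕ → F) : Prop :=
  seqNorm 1 a < ∞ ∧ weakSeqNorm ∞ v < ∞ ∧ ∀ x : E, HasSum (fun j => a j x • v j) (U x)

/-- Nuclear operators. -/
def IsNuclear (U : E →L[ℝ] F) : Prop := ∃ a v, IsNuclearRep U a v

/-- The nuclear norm `ν(U)` (equal to `∞` if `U` is not nuclear). -/
def nuclearNorm (U : E →L[ℝ] F) : ℝ≥0∞ :=
  ⨅ (a : ℕ → StrongDual ℝ E) (v : ℕ → F) (_ : IsNuclearRep U a v),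
    seqNorm 1 a * weakSeqNorm ∞ v

end Nuclear

section Lattice

variable {E X : Type*} [NormedAddCommGroup E] [NormedSpace ℝ E]
  [NormedAddCommGroup X] [NormedSpace ℝ X] [Lattice X]

/-- `T = ∑ x*_j ⊗ u_j` is a positively `p`-nuclear representation:
`(x*_j) ∈ ℓ_{p*}^w(X*)_+`, `(u_j) ∈ ℓ_p(E)`, where `p*` is the conjugate exponent. -/
def IsPosNuclearRep (p : ℝ≥0∞) (T : X →L[ℝ] E) (a : ℕ → StrongDual ℝ X) (u : ℕ → E) : Prop :=
  (∀ j, IsPosFunctional (a j)) ∧ weakSeqNorm p.conjExponent a < ∞ ∧ seqNorm p u < ∞ ∧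
    ∀ x : X, HasSum (fun j => a j x • u j) (T x)

/-- Positively `p`-nuclear operators. -/
def IsPosNuclear (p : ℝ≥0∞) (T : X →L[ℝ] E) : Prop := ∃ a u, IsPosNuclearRep p T a u

/-- The positively `p`-nuclear norm (equal to `∞` if `T` is not positively `p`-nuclear). -/
def posNuclearNorm (p : ℝ≥0∞) (T : X →L[ℝ] E) : ℝ≥0∞ :=
  ⨅ (a : ℕ → StrongDual ℝ X) (u : ℕ → E) (_ : IsPosNuclearRep p T a u),
    weakSeqNorm p.conjExponent a * seqNorm p u

/-- `C` is an admissible constant in the definition of a positive `r`-majorizing operator. -/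
def IsMajorizingBound (r : ℝ≥0∞) (S : E →L[ℝ] X) (C : ℝ≥0) : Prop :=
  ∀ (n : ℕ) (u : Fin n → E) (f : Fin n → StrongDual ℝ X),
    (∀ j, ‖u j‖ ≤ 1) → (∀ j, IsPosFunctional (f j)) →
      seqNorm r (fun j => f j (S (u j))) ≤ C * weakSeqNorm r f

variable (E X) in
/-- The set `Υ_r(E, X)` of positive `r`-majorizing operators. -/
def Upsilon (r : ℝ≥0∞) : Set (E →L[ℝ] X) :=
  {S | ∃ C : ℝ≥0, 0 < C ∧ IsMajorizingBound r S C}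

/-- The norm of `Υ_r`: the infimum of the admissible constants. -/
def upsilonNorm (r : ℝ≥0∞) (S : E →L[ℝ] X) : ℝ≥0∞ :=
  ⨅ (C : ℝ≥0) (_ : 0 < C ∧ IsMajorizingBound r S C), (C : ℝ≥0∞)

variable (E X) in
/-- The set `U_*^p(E, X)` of the operators `S` such that `T S` is nuclear for every positively
`p`-nuclear `T : X → E`. -/
def UStar (p : ℝ≥0∞) : Set (E →L[ℝ] X) :=
  {S | ∀ T : X →L[ℝ] E, IsPosNuclear p T → IsNuclear (T ∘L S)}

/-- The norm `ζ^p(S)`: the operator norm of `T ↦ T S`, from the positively `p`-nuclear operators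
`X → E` (with the positively `p`-nuclear norm) to the nuclear operators on `E`. -/
def zetaNorm (p : ℝ≥0∞) (S : E →L[ℝ] X) : ℝ≥0∞ :=
  ⨆ (T : X →L[ℝ] E) (_ : IsPosNuclear p T ∧ posNuclearNorm p T ≤ 1), nuclearNorm (T ∘L S)

end Lattice

end PosMajorizing

end

/-! If `T = ∑ x_j* ⊗ u_j`, then `TS = ∑ S*x_j* ⊗ u_j`. The majorizing inequality bounds `(‖S*x_j*‖)`
in `ℓ_{p*}`, so Hölder gives `ν(TS) ≤ C ν̃^p(T)` (`IsMajorizingBound.nuclear_comp`).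

Conversely, `∑ c_i f_i(S u_i)` is the trace of `TS` for the finite rank `T = ∑ f_i ⊗ c_i u_i`. The
AP makes the trace independent of the nuclear representation, hence at most `ν(TS)`
(`HasAP.hasSum_trace`). Finite-dimensional `ℓ_p` duality over `c` then turns `ζ^p(S)` into a
majorizing bound (`isMajorizingBound_of_zetaNorm_lt`).

It remains to see that `ζ^p(S) < ∞` on `UStar` (`zetaNorm_lt_top`). This is a closed graph argument,
run on `ℓ_1` spaces that parametrize the operators involved. -/

noncomputable section

namespace PosMajorizing

/-! ### Strong `ℓ_p`-norms: Hölder and duality. -/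

section SeqNorm

variable {ι κ E F : Type*} [NormedAddCommGroup E] [NormedAddCommGroup F] {p : ℝ≥0∞}

theorem seqNorm_top (u : ι → E) : seqNorm ∞ u = ⨆ i, ‖u i‖ₑ := if_pos rfl

theorem seqNorm_one (u : ι → E) : seqNorm 1 u = ∑' i, ‖u i‖ₑ := by
  simp [seqNorm]

theorem seqNorm_of_ne_top (hp : p ≠ ∞) (u : ι → E) :
    seqNorm p u = (∑' i, ‖u i‖ₑ ^ p.toReal) ^ (1 / p.toReal) := if_neg hp

theorem enorm_le_one_of_norm_le_one {x : E} (hx : ‖x‖ ≤ 1) : ‖x‖ₑ ≤ 1 := by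
  rwa [← enorm_one (G := ℝ), enorm_le_iff_norm_le, norm_one]

theorem toReal_pos_of_one_le (hp : 1 ≤ p) (hp' : p ≠ ∞) : 0 < p.toReal :=
  ENNReal.toReal_pos (zero_lt_one.trans_le hp).ne' hp'

theorem seqNorm_le_iff (hp : 1 ≤ p) (hp' : p ≠ ∞) (u : ι → E) (D : ℝ≥0∞) :
    seqNorm p u ≤ D ↔ ∑' i, ‖u i‖ₑ ^ p.toReal ≤ D ^ p.toReal := by
  rw [seqNorm_of_ne_top hp', one_div, ENNReal.rpow_inv_le_iff (toReal_pos_of_one_le hp hp')]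

theorem seqNorm_rpow (hp : 1 ≤ p) (hp' : p ≠ ∞) (u : ι → E) :
    seqNorm p u ^ p.toReal = ∑' i, ‖u i‖ₑ ^ p.toReal := by
  rw [seqNorm_of_ne_top hp', one_div,
    ENNReal.rpow_inv_rpow (toReal_pos_of_one_le hp hp').ne']

theorem seqNorm_mono {u : ι → E} {v : ι → F} (h : ∀ i, ‖u i‖ₑ ≤ ‖v i‖ₑ) :
    seqNorm p u ≤ seqNorm p v := by
  by_cases hp : p = ∞
  · subst hp
    simp only [seqNorm_top]
    exact iSup_mono h
  · simp only [seqNorm_of_ne_top hp]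
    gcongr with i
    exact h i

theorem seqNorm_const_smul [NormedSpace ℝ E] (hp : 1 ≤ p) (c : ℝ) (u : ι → E) :
    seqNorm p (fun i => c • u i) = ‖c‖ₑ * seqNorm p u := by
  by_cases hp' : p = ∞
  · subst hp'
    simp only [seqNorm_top, enorm_smul, ENNReal.mul_iSup]
  · have h0 := toReal_pos_of_one_le hp hp'
    simp only [seqNorm_of_ne_top hp', enorm_smul, ENNReal.mul_rpow_of_nonneg _ _ h0.le,
      ENNReal.tsum_mul_left]
    rw [ENNReal.mul_rpow_of_nonneg _ _ (by positivity), one_div, ENNReal.rpow_rpow_inv h0.ne']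

theorem seqNorm_comp_injective_le {e : κ → ι} (he : e.Injective) (u : ι → E) :
    seqNorm p (u ∘ e) ≤ seqNorm p u := by
  by_cases hp' : p = ∞
  · subst hp'
    simp only [seqNorm_top, Function.comp_apply]
    exact iSup_comp_le (fun i => ‖u i‖ₑ) e
  · simp only [seqNorm_of_ne_top hp', Function.comp_apply]
    gcongr
    exact ENNReal.tsum_comp_le_tsum_of_injective he (fun i => ‖u i‖ₑ ^ p.toReal)

theorem seqNorm_extend_zero (hp : 1 ≤ p) {e : ι → κ} (he : e.Injective) (u : ι → E) :
    seqNorm p (Function.extend e u 0) = seqNorm p u := by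
  by_cases hp' : p = ∞
  · subst hp'
    simp only [seqNorm_top]
    refine le_antisymm (iSup_le fun k => ?_) (iSup_le fun i => ?_)
    · by_cases hk : ∃ i, e i = k
      · obtain ⟨i, rfl⟩ := hk
        rw [he.extend_apply]
        exact le_iSup (fun i => ‖u i‖ₑ) i
      · simp [Function.extend_apply' _ _ _ hk]
    · refine le_of_eq_of_le ?_ (le_iSup _ (e i))
      rw [he.extend_apply]
  · have h0 := toReal_pos_of_one_le hp hp'
    simp only [seqNorm_of_ne_top hp']
    rw [← tsum_extend_zero he]
    congr 2
    ext k
    rw [Function.apply_extend (fun x : E => ‖x‖ₑ ^ p.toReal)]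
    congr 1
    ext
    simp [h0]

/-- With `N i` the norm of the `i`-th row, `N i ^ p ≤ N i * (∑ N) ^ (p - 1)`; summing over `i` gives
the claim. -/
theorem seqNorm_prod_le_tsum (hp : 1 ≤ p) (w : ι → κ → E) :
    seqNorm p (fun x : ι × κ => w x.1 x.2) ≤ ∑' i, seqNorm p (w i) := by
  by_cases hp' : p = ∞
  · subst hp'
    rw [seqNorm_top]
    refine iSup_le fun x => le_trans ?_ (ENNReal.le_tsum x.1)
    rw [seqNorm_top]
    exact le_iSup (fun j => ‖w x.1 j‖ₑ) x.2
  · have h0 := toReal_pos_of_one_le hp hp'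
    have h1 : 1 ≤ p.toReal := by
      simpa using ENNReal.toReal_mono hp' hp
    rw [seqNorm_le_iff hp hp', ENNReal.tsum_prod (f := fun i j => ‖w i j‖ₑ ^ p.toReal)]
    simp only [← seqNorm_rpow hp hp']
    set N := fun i => seqNorm p (w i)
    have key : ∀ x : ℝ≥0∞, x ^ p.toReal = x * x ^ (p.toReal - 1) := by
      intro x
      conv_lhs => rw [show p.toReal = 1 + (p.toReal - 1) by ring,
        ENNReal.rpow_add_of_nonneg _ _ zero_le_one (by linarith), ENNReal.rpow_one]
    calc ∑' i, N i ^ p.toReal = ∑' i, N i * N i ^ (p.toReal - 1) := by simp only [key]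
      _ ≤ ∑' i, N i * (∑' i, N i) ^ (p.toReal - 1) := by
        gcongr with i
        exact ENNReal.le_tsum i
      _ = (∑' i, N i) ^ p.toReal := by rw [ENNReal.tsum_mul_right, ← key]

theorem seqNorm_le_of_forall_fin (hp : 1 ≤ p) (u : ℕ → E) (D : ℝ≥0∞)
    (h : ∀ n, seqNorm p (fun i : Fin n => u i) ≤ D) : seqNorm p u ≤ D := by
  by_cases hp' : p = ∞
  · subst hp'
    simp only [seqNorm_top] at h ⊢
    exact iSup_le fun i => (le_iSup (fun j : Fin (i + 1) => ‖u j‖ₑ) (Fin.last i)).trans (h (i + 1))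
  · simp only [seqNorm_le_iff hp hp'] at h ⊢
    rw [ENNReal.tsum_eq_iSup_nat]
    refine iSup_le fun n => le_trans (le_of_eq ?_) (h n)
    rw [tsum_fintype, Finset.sum_range]

theorem conjExponent_cases (hp : 1 ≤ p) :
    (p = 1 ∧ p.conjExponent = ∞) ∨ (p = ∞ ∧ p.conjExponent = 1) ∨
      (p ≠ ∞ ∧ p.conjExponent ≠ ∞ ∧ p.toReal.HolderConjugate p.conjExponent.toReal) := by
  have h := ENNReal.HolderConjugate.conjExponent hp
  by_cases h1 : p = 1
  · subst h1
    left
    simp [ENNReal.conjExponent]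
  by_cases h2 : p = ∞
  · subst h2
    right; left
    simp [ENNReal.conjExponent]
  right; right
  have h3 : p.conjExponent ≠ ∞ := by
    have := h.symm
    rw [Ne, ENNReal.HolderConjugate.eq_top_iff_eq_one (p := p.conjExponent) (q := p)]
    exact h1
  refine ⟨h2, h3, ?_⟩
  exact h.toReal_of_ne_top h2 h3

theorem one_le_conjExponent (hp : 1 ≤ p) : 1 ≤ p.conjExponent := by
  have := (ENNReal.HolderConjugate.conjExponent hp).symm
  exact ENNReal.HolderConjugate.one_le p.conjExponent p

theorem tsum_enorm_mul_enorm_le (hp : 1 ≤ p) (a : ι → E) (b : ι → F) :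
    ∑' i, ‖a i‖ₑ * ‖b i‖ₑ ≤ seqNorm p.conjExponent a * seqNorm p b := by
  rcases conjExponent_cases hp with ⟨h, h'⟩ | ⟨h, h'⟩ | ⟨h, h', hc⟩
  · rw [h', h, seqNorm_top, seqNorm_one, ← ENNReal.tsum_mul_left]
    gcongr with i
    exact le_iSup (fun i => ‖a i‖ₑ) i
  · rw [h', h, seqNorm_top, seqNorm_one, ← ENNReal.tsum_mul_right]
    gcongr with i
    exact le_iSup (fun i => ‖b i‖ₑ) i
  · rw [seqNorm_of_ne_top h, seqNorm_of_ne_top h', ENNReal.tsum_eq_iSup_sum]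
    refine iSup_le fun s => (ENNReal.inner_le_Lp_mul_Lq s _ _ hc.symm).trans ?_
    gcongr <;> exact ENNReal.sum_le_tsum s

/-- Norming vectors `c`: a coordinate vector for `p = 1`, the signs of `t` for `p = ∞`, and
otherwise the Hölder extremizer of `|t|` multiplied by those signs. -/
theorem seqNorm_conjExponent_le {n : ℕ} (hp : 1 ≤ p) (t : Fin n → ℝ) (D : ℝ≥0∞)
    (h : ∀ c : Fin n → ℝ, seqNorm p c ≤ 1 → ‖∑ i, c i * t i‖ₑ ≤ D) :
    seqNorm p.conjExponent t ≤ D := by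
  rcases conjExponent_cases hp with ⟨h1, h'⟩ | ⟨h1, h'⟩ | ⟨h1, h', hc⟩
  · rw [h', seqNorm_top]
    refine iSup_le fun i => ?_
    refine le_of_eq_of_le ?_ (h (Pi.single i 1) ?_)
    · simp [Pi.single_apply]
    · rw [h1, seqNorm_one, tsum_eq_single i]
      · simp
      · intro j hj
        simp [hj]
  · rw [h', seqNorm_one]
    have := h (fun i => SignType.sign (t i)) ?_
    · refine le_trans (le_of_eq ?_) this
      rw [tsum_fintype]
      simp only [sign_mul_self]
      rw [Real.enorm_of_nonneg (Finset.sum_nonneg fun i _ => abs_nonneg _),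
        ENNReal.ofReal_sum_of_nonneg fun i _ => abs_nonneg _]
      refine Finset.sum_congr rfl fun i _ => ?_
      rw [Real.enorm_eq_ofReal_abs]
    · rw [h1, seqNorm_top]
      refine iSup_le fun i => ?_
      rcases lt_trichotomy (t i) 0 with hi | hi | hi <;> simp [hi]
  · obtain ⟨⟨g, hg, hg'⟩, -⟩ := NNReal.isGreatest_Lp Finset.univ (fun i => ‖t i‖₊) hc.symm
    simp only [Set.mem_ofPred_eq] at hg
    have hq := hc.symm.pos
    have e1 : seqNorm p.conjExponent t =
        (((∑ i, ‖t i‖₊ ^ p.conjExponent.toReal) ^ (1 / p.conjExponent.toReal) : ℝ≥0) : ℝ≥0∞) := by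
      rw [seqNorm_of_ne_top h', tsum_fintype, ENNReal.coe_rpow_of_nonneg _ (by positivity)]
      push_cast
      congr 1
      refine Finset.sum_congr rfl fun i _ => ?_
      rw [ENNReal.coe_rpow_of_nonneg _ hq.le]
      rfl
    rw [e1, ← hg']
    refine le_trans (le_of_eq ?_) (h (fun i => SignType.sign (t i) * g i) ?_)
    · have : ∑ i, (SignType.sign (t i) : ℝ) * g i * t i = ∑ i, |t i| * g i := by
        refine Finset.sum_congr rfl fun i _ => ?_
        rw [← sign_mul_self]
        ring
      rw [this, Real.enorm_of_nonneg (Finset.sum_nonneg fun i _ => by positivity),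
        ← ENNReal.ofReal_coe_nnreal]
      push_cast
      rfl
    · rw [seqNorm_le_iff hp h1, ENNReal.one_rpow, tsum_fintype]
      have hg2 : ∑ i, ((g i ^ p.toReal : ℝ≥0) : ℝ≥0∞) ≤ 1 := by exact_mod_cast hg
      refine le_trans (Finset.sum_le_sum fun i _ => ?_) hg2
      rw [ENNReal.coe_rpow_of_nonneg _ hc.pos.le]
      refine ENNReal.rpow_le_rpow ?_ hc.pos.le
      rcases lt_trichotomy (t i) 0 with hi | hi | hi <;> simp [hi]

end SeqNorm

/-! ### Weak `ℓ_p`-norms. -/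

section WeakSeqNorm

variable {ι κ E F : Type*} [NormedAddCommGroup E] [NormedSpace ℝ E]
  [NormedAddCommGroup F] [NormedSpace ℝ F] {p : ℝ≥0∞}

theorem seqNorm_le_weakSeqNorm (u : ι → E) {φ : StrongDual ℝ E} (hφ : ‖φ‖ ≤ 1) :
    seqNorm p (fun i => φ (u i)) ≤ weakSeqNorm p u :=
  le_iSup₂ (f := fun (φ : StrongDual ℝ E) (_ : ‖φ‖ ≤ 1) => seqNorm p (fun i => φ (u i))) φ hφ

theorem seqNorm_apply_le (hp : 1 ≤ p) (u : ι → E) (φ : StrongDual ℝ E) :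
    seqNorm p (fun i => φ (u i)) ≤ ‖φ‖ₑ * weakSeqNorm p u := by
  by_cases h : ‖φ‖ = 0
  · have : φ = 0 := norm_eq_zero.mp h
    subst this
    have := seqNorm_const_smul hp (0 : ℝ) (fun _ : ι => (0 : ℝ))
    simp only [zero_smul, enorm_zero, zero_mul] at this
    simp [this]
  · have h1 : ‖‖φ‖⁻¹ • φ‖ ≤ 1 := by
      rw [norm_smul, norm_inv, norm_norm, inv_mul_cancel₀ h]
    refine le_of_eq_of_le ?_ (mul_le_mul_right (seqNorm_le_weakSeqNorm u h1) ‖φ‖ₑ)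
    have := seqNorm_const_smul hp ‖φ‖ (fun i => (‖φ‖⁻¹ • φ) (u i))
    rw [enorm_norm] at this
    rw [← this]
    congr 1
    ext i
    simp [mul_inv_cancel_left₀ h]

/-- Evaluation at `x` is an element of the bidual of norm at most `‖x‖`. -/
theorem seqNorm_eval_le (hp : 1 ≤ p) (f : ι → StrongDual ℝ E) (x : E) :
    seqNorm p (fun i => f i x) ≤ ‖x‖ₑ * weakSeqNorm p f := by
  refine (seqNorm_apply_le hp f (NormedSpace.inclusionInDoubleDual ℝ E x)).trans ?_
  gcongr
  exact enorm_le_iff_norm_le.mpr (NormedSpace.double_dual_bound ℝ E x)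

theorem enorm_le_weakSeqNorm_top (v : ι → E) (i : ι) : ‖v i‖ₑ ≤ weakSeqNorm ∞ v := by
  obtain ⟨g, hg, hg'⟩ := exists_dual_vector'' ℝ (v i)
  refine le_trans ?_ (seqNorm_le_weakSeqNorm v hg)
  rw [seqNorm_top]
  refine le_of_eq_of_le ?_ (le_iSup (fun i => ‖g (v i)‖ₑ) i)
  rw [hg']
  simp

theorem weakSeqNorm_top_le {v : ι → E} {D : ℝ≥0∞} (h : ∀ i, ‖v i‖ₑ ≤ D) :
    weakSeqNorm ∞ v ≤ D := by
  refine iSup₂_le fun φ hφ => ?_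
  rw [seqNorm_top]
  refine iSup_le fun i => le_trans ?_ (h i)
  exact enorm_le_iff_norm_le.mpr ((φ.le_opNorm _).trans (mul_le_of_le_one_left (norm_nonneg _) hφ))

theorem weakSeqNorm_const_smul (hp : 1 ≤ p) (c : ℝ) (u : ι → E) :
    weakSeqNorm p (fun i => c • u i) = ‖c‖ₑ * weakSeqNorm p u := by
  simp only [weakSeqNorm, map_smul, ENNReal.mul_iSup, seqNorm_const_smul hp]

theorem weakSeqNorm_comp_injective_le {e : κ → ι} (he : e.Injective) (u : ι → E) :
    weakSeqNorm p (u ∘ e) ≤ weakSeqNorm p u :=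
  iSup₂_mono fun φ _ => seqNorm_comp_injective_le he (fun i => φ (u i))

theorem weakSeqNorm_extend_zero (hp : 1 ≤ p) {e : ι → κ} (he : e.Injective) (u : ι → E) :
    weakSeqNorm p (Function.extend e u 0) = weakSeqNorm p u := by
  simp only [weakSeqNorm]
  congr! 4 with φ hφ
  rw [← seqNorm_extend_zero hp he]
  congr 1
  ext k
  rw [Function.apply_extend φ]
  congr 1
  ext
  simp

theorem weakSeqNorm_prod_le_tsum (hp : 1 ≤ p) (w : ι → κ → E) :
    weakSeqNorm p (fun x : ι × κ => w x.1 x.2) ≤ ∑' i, weakSeqNorm p (w i) :=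
  iSup₂_le fun φ hφ => (seqNorm_prod_le_tsum hp (fun i j => φ (w i j))).trans
    (ENNReal.tsum_le_tsum fun i => seqNorm_le_weakSeqNorm (w i) hφ)

end WeakSeqNorm

/-! ### Representations over countable index types. -/

section Families

variable {ι E F : Type*} [NormedAddCommGroup E] [NormedSpace ℝ E]
  [NormedAddCommGroup F] [NormedSpace ℝ F]

theorem hasSum_extend_zero_smul {e : ι → ℕ} (he : e.Injective) (a : ι → StrongDual ℝ E)
    (v : ι → F) {x : E} {y : F} (h : HasSum (fun i => a i x • v i) y) :
    HasSum (fun j => Function.extend e a 0 j x • Function.extend e v 0 j) y := by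
  rw [← hasSum_extend_zero he] at h
  convert h using 2 with j
  by_cases hj : ∃ i, e i = j
  · obtain ⟨i, rfl⟩ := hj
    simp only [he.extend_apply]
  · simp [Function.extend_apply' _ _ _ hj]

/-- A nuclear representation indexed by a countable type. -/
theorem isNuclear_of_family [Countable ι] {U : E →L[ℝ] F} {a : ι → StrongDual ℝ E} {v : ι → F}
    (ha : seqNorm 1 a < ∞) (hv : weakSeqNorm ∞ v < ∞)
    (hU : ∀ x, HasSum (fun i => a i x • v i) (U x)) :
    IsNuclear U ∧ nuclearNorm U ≤ seqNorm 1 a * weakSeqNorm ∞ v := by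
  obtain ⟨e, he⟩ := exists_injective_nat ι
  have hrep : IsNuclearRep U (Function.extend e a 0) (Function.extend e v 0) :=
    ⟨by rwa [seqNorm_extend_zero le_rfl he], by rwa [weakSeqNorm_extend_zero le_top he],
      fun x => hasSum_extend_zero_smul he a v (hU x)⟩
  refine ⟨⟨_, _, hrep⟩, (iInf₂_le_of_le _ _ (iInf_le _ hrep)).trans ?_⟩
  rw [seqNorm_extend_zero le_rfl he, weakSeqNorm_extend_zero le_top he]

theorem tsum_enorm_smul_le {p : ℝ≥0∞} (hp : 1 ≤ p) (a : ι → StrongDual ℝ E) (u : ι → F) (x : E) :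
    ∑' i, ‖a i x • u i‖ₑ ≤ ‖x‖ₑ * weakSeqNorm p.conjExponent a * seqNorm p u := by
  simp only [enorm_smul]
  refine (tsum_enorm_mul_enorm_le hp (fun i => a i x) u).trans ?_
  gcongr
  exact seqNorm_eval_le (one_le_conjExponent hp) a x

variable {X : Type*} [NormedAddCommGroup X] [NormedSpace ℝ X] [Lattice X] {p : ℝ≥0∞}

/-- A positively `p`-nuclear representation indexed by a countable type. -/
theorem isPosNuclear_of_family [Countable ι] (hp : 1 ≤ p) {T : X →L[ℝ] E}
    {a : ι → StrongDual ℝ X} {u : ι → E} (hpos : ∀ i, IsPosFunctional (a i))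
    (ha : weakSeqNorm p.conjExponent a < ∞) (hu : seqNorm p u < ∞)
    (hT : ∀ x, HasSum (fun i => a i x • u i) (T x)) :
    IsPosNuclear p T ∧ posNuclearNorm p T ≤ weakSeqNorm p.conjExponent a * seqNorm p u := by
  obtain ⟨e, he⟩ := exists_injective_nat ι
  have hq := one_le_conjExponent hp
  have hrep : IsPosNuclearRep p T (Function.extend e a 0) (Function.extend e u 0) := by
    refine ⟨fun j x hx => ?_, by rwa [weakSeqNorm_extend_zero hq he],
      by rwa [seqNorm_extend_zero hp he], fun x => hasSum_extend_zero_smul he a u (hT x)⟩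
    by_cases hj : ∃ i, e i = j
    · obtain ⟨i, rfl⟩ := hj
      rw [he.extend_apply]
      exact hpos i x hx
    · simp [Function.extend_apply' _ _ _ hj]
  refine ⟨⟨_, _, hrep⟩, (iInf₂_le_of_le _ _ (iInf_le _ hrep)).trans ?_⟩
  rw [seqNorm_extend_zero hp he, weakSeqNorm_extend_zero hq he]

end Families

/-! ### Majorizing operators yield nuclear compositions. -/

section Majorizing

variable {E X : Type*} [NormedAddCommGroup E] [NormedSpace ℝ E]
  [NormedAddCommGroup X] [NormedSpace ℝ X] [Lattice X] {p q : ℝ≥0∞}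

theorem exists_mul_norm_le_apply (g : StrongDual ℝ E) {θ : ℝ} (hθ : θ < 1) :
    ∃ u : E, ‖u‖ ≤ 1 ∧ θ * ‖g‖ ≤ ‖g u‖ := by
  by_cases h : ‖g‖ = 0
  · exact ⟨0, by simp, by simp [h]⟩
  · have h0 : 0 < ‖g‖ := lt_of_le_of_ne (norm_nonneg _) (Ne.symm h)
    obtain ⟨u, hu, hu'⟩ := g.exists_lt_apply_of_lt_opNorm (r := θ * ‖g‖) (by nlinarith)
    exact ⟨u, hu.le, hu'.le⟩

/-- Choosing `u_j` that nearly norm `f_j ∘ S` upgrades the scalars `f_j (S u_j)` to the norms `‖f_j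
∘ S‖`, at the cost of a factor `θ < 1` that tends to `1`. -/
theorem IsMajorizingBound.seqNorm_comp_le (hq : 1 ≤ q) {S : E →L[ℝ] X} {C : ℝ≥0}
    (h : IsMajorizingBound q S C) {f : ℕ → StrongDual ℝ X} (hf : ∀ j, IsPosFunctional (f j)) :
    seqNorm q (fun j => f j ∘L S) ≤ C * weakSeqNorm q f := by
  refine seqNorm_le_of_forall_fin hq _ _ fun n => ?_
  rw [← one_mul (seqNorm q _)]
  refine ENNReal.mul_le_of_forall_lt fun θ hθ b hb => ?_
  lift θ to ℝ≥0 using hθ.ne_top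
  have hθ' : (θ : ℝ) < 1 := by exact_mod_cast hθ
  choose u hu hu' using fun j : Fin n => exists_mul_norm_le_apply (f j ∘L S) hθ'
  calc (θ : ℝ≥0∞) * b ≤ θ * seqNorm q (fun j : Fin n => f j ∘L S) := by gcongr
    _ = seqNorm q (fun j : Fin n => (θ : ℝ) • (f j ∘L S)) := by
      rw [seqNorm_const_smul hq]; simp
    _ ≤ seqNorm q (fun j : Fin n => f j (S (u j))) := by
      refine seqNorm_mono fun j => enorm_le_iff_norm_le.mpr ?_
      rw [norm_smul]
      simpa using hu' j
    _ ≤ C * weakSeqNorm q (fun j : Fin n => f j) := h n u _ hu fun j => hf j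
    _ ≤ C * weakSeqNorm q f := by
      gcongr
      exact weakSeqNorm_comp_injective_le Fin.val_injective f

theorem IsMajorizingBound.nuclear_comp (hp : 1 ≤ p) {S : E →L[ℝ] X} {C : ℝ≥0}
    (h : IsMajorizingBound p.conjExponent S C) {T : X →L[ℝ] E} {a : ℕ → StrongDual ℝ X}
    {u : ℕ → E} (hT : IsPosNuclearRep p T a u) :
    IsNuclear (T ∘L S) ∧
      nuclearNorm (T ∘L S) ≤ C * (weakSeqNorm p.conjExponent a * seqNorm p u) := by
  obtain ⟨hpos, ha, hu, hsum⟩ := hT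
  -- The norm of `u j` is moved to the functional, leaving vectors in the unit ball; Hölder then
  -- controls the `ℓ_1`-norm.
  have h1 : seqNorm 1 (fun j => ‖u j‖ • (a j ∘L S)) ≤
      C * (weakSeqNorm p.conjExponent a * seqNorm p u) := by
    rw [seqNorm_one]
    simp only [enorm_smul, enorm_norm]
    simp only [mul_comm ‖u _‖ₑ]
    refine (tsum_enorm_mul_enorm_le hp _ _).trans ?_
    rw [← mul_assoc]
    gcongr
    exact h.seqNorm_comp_le (one_le_conjExponent hp) hpos
  have h2 : weakSeqNorm ∞ (fun j => ‖u j‖⁻¹ • u j) ≤ 1 := by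
    refine weakSeqNorm_top_le fun j => ?_
    refine enorm_le_one_of_norm_le_one ?_
    rw [norm_smul, norm_inv, norm_norm]
    exact inv_mul_le_one
  have h3 := isNuclear_of_family (U := T ∘L S)
    (h1.trans_lt (ENNReal.mul_lt_top ENNReal.coe_lt_top (ENNReal.mul_lt_top ha hu)))
    (h2.trans_lt ENNReal.one_lt_top) (fun x => ?_)
  · exact ⟨h3.1, h3.2.trans (by simpa using mul_le_mul' h1 h2)⟩
  · convert hsum (S x) using 2 with j
    by_cases hj : u j = 0
    · simp [hj]
    · have : ‖u j‖ ≠ 0 := norm_ne_zero_iff.mpr hj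
      simp only [smul_smul, smul_apply, ContinuousLinearMap.comp_apply,
        smul_eq_mul]
      congr 1
      field_simp
    rfl

theorem IsMajorizingBound.nuclearNorm_comp_le (hp : 1 ≤ p) {S : E →L[ℝ] X} {C : ℝ≥0}
    (hC : 0 < C) (h : IsMajorizingBound p.conjExponent S C) (T : X →L[ℝ] E) :
    nuclearNorm (T ∘L S) ≤ C * posNuclearNorm p T := by
  have h0 : (C : ℝ≥0∞) ≠ 0 := by exact_mod_cast hC.ne'
  simp only [posNuclearNorm, ENNReal.mul_iInf_of_ne h0 ENNReal.coe_ne_top]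
  exact le_iInf₂ fun a u => le_iInf fun hT => (h.nuclear_comp hp hT).2

end Majorizing

/-! ### The trace in a space with the AP. -/

section Trace

variable {E : Type*} [NormedAddCommGroup E] [NormedSpace ℝ E]

/-- Writing `R = ∑ b_k ⊗ B_k` over a basis of its range, both expressions for the trace of `R U`
become `∑_k b_k(U B_k)`. The sum over `k` is finite, so no AP is needed. -/
theorem hasSum_apply_finiteRank {F : Type*} [NormedAddCommGroup F] [NormedSpace ℝ F]
    {U : E →L[ℝ] F} {a : ℕ → StrongDual ℝ E} {v : ℕ → F}
    (hU : ∀ x, HasSum (fun j => a j x • v j) (U x)) {n : ℕ} {x : Fin n → StrongDual ℝ E}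
    {y : Fin n → F} (hxy : ∀ z, U z = ∑ i, x i z • y i) (R : F →L[ℝ] E)
    [FiniteDimensional ℝ (LinearMap.range (R : F →ₗ[ℝ] E))] :
    HasSum (fun j => a j (R (v j))) (∑ i, x i (R (y i))) := by
  set V := LinearMap.range (R : F →ₗ[ℝ] E)
  let B := Module.finBasis ℝ V
  let R' : F →L[ℝ] V := R.codRestrict V fun z => ⟨z, rfl⟩
  let b : Fin (Module.finrank ℝ V) → StrongDual ℝ F :=
    fun k => (B.coord k).toContinuousLinearMap ∘L R'
  have hR : ∀ z, R z = ∑ k, b k z • (B k : E) := by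
    intro z
    have := congrArg (Subtype.val) (B.sum_repr (R' z))
    rw [Submodule.coe_sum] at this
    exact this.symm
  have h1 : ∀ k, HasSum (fun j => a j (B k) * b k (v j)) (b k (U (B k))) := by
    intro k
    simpa using (b k).hasSum (hU (B k))
  convert hasSum_sum (s := Finset.univ) fun k _ => h1 k using 1
  · ext j
    rw [hR, map_sum]
    simp [mul_comm]
  · simp only [hxy, hR, map_sum, map_smul, smul_eq_mul]
    rw [Finset.sum_comm]
    exact Finset.sum_congr rfl fun k _ => Finset.sum_congr rfl fun i _ => mul_comm _ _

/-- In a space with the approximation property, the trace of a finite rank operator can be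
computed from any of its nuclear representations. -/
theorem HasAP.hasSum_trace (hE : HasAP E) {U : E →L[ℝ] E} {a : ℕ → StrongDual ℝ E} {v : ℕ → E}
    (h : IsNuclearRep U a v) {n : ℕ} {x : Fin n → StrongDual ℝ E} {y : Fin n → E}
    (hxy : ∀ z, U z = ∑ i, x i z • y i) :
    HasSum (fun j => a j (v j)) (∑ i, x i (y i)) := by
  obtain ⟨ha, hv, hU⟩ := h
  obtain ⟨M, hM⟩ : ∃ M : ℝ≥0, weakSeqNorm ∞ v = M := ⟨_, (ENNReal.coe_toNNReal hv.ne).symm⟩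
  have hvM : ∀ j, ‖v j‖ ≤ M := fun j => by
    have := enorm_le_weakSeqNorm_top v j
    rw [hM] at this
    exact_mod_cast enorm_le_coe.mp this
  have hsa : Summable fun j => ‖a j‖ := by
    rw [seqNorm_one] at ha
    rw [← tsum_enorm_ne_top_iff_summable_norm]
    exact ha.ne
  have hs : Summable fun j => a j (v j) := by
    refine Summable.of_norm_bounded (hsa.mul_right (M : ℝ)) fun j => ?_
    exact ((a j).le_opNorm _).trans (by gcongr; exact hvM j)
  -- The `v j` are only bounded. The tails `r j` give weights `√(r j) → 0` that make `√(r j) • v j`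
  -- a null sequence, while `‖a j‖ / √(r j)` stays summable where `r j > 0`.
  set r : ℕ → ℝ := fun j => ∑' k, ‖a (k + j)‖ with hr
  have hr0 : ∀ j, 0 ≤ r j := fun j => tsum_nonneg fun k => norm_nonneg _
  have hrs : ∀ j, r j = ‖a j‖ + r (j + 1) := by
    intro j
    have := ((summable_nat_add_iff j).mpr hsa).tsum_eq_zero_add
    simp only [hr, this, zero_add]
    congr 2
    ext k
    rw [add_right_comm, add_assoc]
  have hrt : Filter.Tendsto r Filter.atTop (nhds 0) := tendsto_sum_nat_add fun j => ‖a j‖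
  have hwt : Filter.Tendsto (fun j => √(r j) • v j) Filter.atTop (nhds 0) := by
    rw [tendsto_zero_iff_norm_tendsto_zero]
    have h1 : Filter.Tendsto (fun j => √(r j) * M) Filter.atTop (nhds 0) := by
      simpa using (hrt.sqrt).mul_const (M : ℝ)
    refine squeeze_zero (fun _ => norm_nonneg _) (fun j => ?_) h1
    rw [norm_smul, Real.norm_of_nonneg (Real.sqrt_nonneg _)]
    gcongr
    exact hvM j
  have hK : IsCompact (insert 0 (Set.range fun j => √(r j) • v j) ∪ Set.range y) :=
    hwt.isCompact_insert_range.union (Set.finite_range y).isCompact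
  -- `R` from the AP moves points of the compact set by less than `ε`: the null sequence controls
  -- the series, the points `y i` control the finite sum.
  suffices key : ∀ ε : ℝ, 0 < ε →
      ‖∑' j, a j (v j) - ∑ i, x i (y i)‖ ≤ ε * (2 * √(r 0) + ∑ i, ‖x i‖) by
    have h2 : Filter.Tendsto (fun ε : ℝ => ε * (2 * √(r 0) + ∑ i, ‖x i‖))
        (nhdsWithin 0 (Set.Ioi 0)) (nhds 0) := by
      refine Filter.Tendsto.mono_left ?_ nhdsWithin_le_nhds
      have : Continuous fun ε : ℝ => ε * (2 * √(r 0) + ∑ i, ‖x i‖) := by fun_prop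
      simpa using this.tendsto 0
    have h3 : ‖∑' j, a j (v j) - ∑ i, x i (y i)‖ ≤ 0 :=
      ge_of_tendsto h2 (Filter.eventually_of_mem self_mem_nhdsWithin key)
    rw [← sub_eq_zero.mp (norm_le_zero_iff.mp h3)]
    exact hs.hasSum
  intro ε hε
  obtain ⟨R, hfin, hR⟩ := hE ε hε _ hK
  have hsum := hasSum_apply_finiteRank hU hxy R
  have hterm : ∀ j, ‖a j (v j) - a j (R (v j))‖ ≤ 2 * ε * (√(r j) - √(r (j + 1))) := by
    intro j
    have hle : √(r (j + 1)) ≤ √(r j) :=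
      Real.sqrt_le_sqrt (by rw [hrs j]; linarith [norm_nonneg (a j)])
    rcases (Real.sqrt_nonneg (r j)).eq_or_lt with h0 | h0
    · have h1 : ‖a j‖ = 0 := by
        have := Real.sqrt_eq_zero'.mp h0.symm
        linarith [hrs j, hr0 (j + 1), norm_nonneg (a j)]
      rw [norm_eq_zero.mp h1]
      simp only [zero_apply, sub_zero, norm_zero]
      have := sub_nonneg.mpr hle
      positivity
    · have h1 : √(r j) * ‖R (v j) - v j‖ ≤ ε := by
        have := (hR (√(r j) • v j) (Or.inl (Or.inr ⟨j, rfl⟩))).le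
        rwa [map_smul, ← smul_sub, norm_smul, Real.norm_of_nonneg h0.le] at this
      -- `‖a j‖ = r j - r (j + 1)` factors as a difference of squares, and the sum of the two roots
      -- is at most `2 √(r j)`; the resulting bound telescopes.
      have h2 : ‖a j‖ ≤ 2 * √(r j) * (√(r j) - √(r (j + 1))) := by
        have e1 := Real.sq_sqrt (hr0 j)
        have e2 := Real.sq_sqrt (hr0 (j + 1))
        nlinarith [hrs j, sq_nonneg (√(r j) - √(r (j + 1)))]
      calc ‖a j (v j) - a j (R (v j))‖ = ‖a j (R (v j) - v j)‖ := by
            rw [map_sub, norm_sub_rev]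
        _ ≤ ‖a j‖ * ‖R (v j) - v j‖ := (a j).le_opNorm _
        _ ≤ 2 * √(r j) * (√(r j) - √(r (j + 1))) * ‖R (v j) - v j‖ := by gcongr
        _ = 2 * (√(r j) - √(r (j + 1))) * (√(r j) * ‖R (v j) - v j‖) := by ring
        _ ≤ 2 * (√(r j) - √(r (j + 1))) * ε := by
            have := sub_nonneg.mpr hle
            gcongr
        _ = _ := by ring
  have h4 : ‖∑' j, a j (v j) - ∑ i, x i (R (y i))‖ ≤ 2 * ε * √(r 0) := by
    refine le_of_tendsto (hs.hasSum.sub hsum).tendsto_sum_nat.norm (Filter.Eventually.of_forall ?_)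
    intro m
    refine (norm_sum_le_of_le _ fun j _ => hterm j).trans ?_
    rw [← Finset.mul_sum, Finset.sum_range_sub']
    gcongr
    linarith [Real.sqrt_nonneg (r m)]
  have h5 : ‖∑ i, x i (R (y i)) - ∑ i, x i (y i)‖ ≤ ∑ i, ‖x i‖ * ε := by
    rw [← Finset.sum_sub_distrib]
    refine norm_sum_le_of_le _ fun i _ => ?_
    rw [← map_sub]
    exact ((x i).le_opNorm _).trans (by gcongr; exact (hR (y i) (Or.inr ⟨i, rfl⟩)).le)
  calc _ ≤ ‖∑' j, a j (v j) - ∑ i, x i (R (y i))‖ +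
        ‖∑ i, x i (R (y i)) - ∑ i, x i (y i)‖ := norm_sub_le_norm_sub_add_norm_sub _ _ _
    _ ≤ 2 * ε * √(r 0) + ∑ i, ‖x i‖ * ε := add_le_add h4 h5
    _ = _ := by rw [← Finset.sum_mul]; ring

theorem HasAP.enorm_trace_le_nuclearNorm (hE : HasAP E) {U : E →L[ℝ] E} {n : ℕ}
    {x : Fin n → StrongDual ℝ E} {y : Fin n → E} (hxy : ∀ z, U z = ∑ i, x i z • y i) :
    ‖∑ i, x i (y i)‖ₑ ≤ nuclearNorm U := by
  refine le_iInf₂ fun a v => le_iInf fun h => ?_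
  have h1 := hE.hasSum_trace h hxy
  rw [← h1.tsum_eq, seqNorm_one, ← ENNReal.tsum_mul_right]
  refine enorm_tsum_le_tsum_enorm.trans (ENNReal.tsum_le_tsum fun j => ?_)
  refine ((a j).le_opENorm _).trans ?_
  gcongr
  exact enorm_le_weakSeqNorm_top v j

end Trace

/-! ### Trace duality: `ζ^p(S)` controls the majorizing constant. -/

section LowerBound

variable {E X : Type*} [NormedAddCommGroup E] [NormedSpace ℝ E]
  [NormedAddCommGroup X] [NormedSpace ℝ X] [Lattice X] {p : ℝ≥0∞}

theorem enorm_sum_le_zetaNorm (hE : HasAP E) (hp : 1 ≤ p) (S : E →L[ℝ] X) {n : ℕ}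
    {f : Fin n → StrongDual ℝ X} (hf : ∀ i, IsPosFunctional (f i)) {y : Fin n → E}
    (hfin : weakSeqNorm p.conjExponent f < ∞) (hy : seqNorm p y < ∞)
    (hle : weakSeqNorm p.conjExponent f * seqNorm p y ≤ 1) :
    ‖∑ i, f i (S (y i))‖ₑ ≤ zetaNorm p S := by
  let T : X →L[ℝ] E := ∑ i, (f i).smulRight (y i)
  have hT : ∀ x, T x = ∑ i, f i x • y i := fun x => by simp [T]
  obtain ⟨h1, h2⟩ := isPosNuclear_of_family (T := T) hp hf hfin hy fun x => by
    rw [hT]; exact hasSum_fintype _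
  refine (hE.enorm_trace_le_nuclearNorm (U := T ∘L S) (x := fun i => f i ∘L S) (y := y)
    fun z => hT (S z)).trans ?_
  exact le_iSup₂ (f := fun (T : X →L[ℝ] E) (_ : IsPosNuclear p T ∧ posNuclearNorm p T ≤ 1) =>
    nuclearNorm (T ∘L S)) T ⟨h1, h2.trans hle⟩

theorem isMajorizingBound_of_zetaNorm_lt (hE : HasAP E) (hp : 1 ≤ p) {S : E →L[ℝ] X} {C : ℝ≥0}
    (hC : zetaNorm p S < C) : IsMajorizingBound p.conjExponent S C := by
  intro n u f hu hf
  have hC0 : (C : ℝ≥0∞) ≠ 0 := (bot_le.trans_lt hC).ne'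
  by_cases hw : weakSeqNorm p.conjExponent f = ∞
  · rw [hw, ENNReal.mul_top hC0]
    exact le_top
  -- A number `s` strictly above the weak norm is positive even when that norm vanishes, so it can
  -- be divided by.
  refine ENNReal.le_mul_of_forall_lt (Or.inl hC0) (Or.inl ENNReal.coe_ne_top)
    fun C' hC' s hs => ?_
  by_cases hs' : s = ∞
  · rw [hs', ENNReal.mul_top (bot_le.trans_lt hC').ne']
    exact le_top
  lift s to ℝ≥0 using hs'
  have hs0 : s ≠ 0 := by
    rintro rfl
    simp at hs
  refine le_trans ?_ (mul_le_mul_left hC'.le _)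
  refine seqNorm_conjExponent_le hp _ _ fun c hc => ?_
  have hsinv : ‖((s : ℝ))⁻¹‖ₑ = (s : ℝ≥0∞)⁻¹ := by
    rw [enorm_inv (by exact_mod_cast hs0)]
    simp
  -- The factor `s⁻¹` normalizes the finite rank operator `∑ f_i ⊗ s⁻¹ c_i u_i` to positively
  -- `p`-nuclear norm at most `1`.
  have hy : seqNorm p (fun i => (s : ℝ)⁻¹ • c i • u i) ≤ (s : ℝ≥0∞)⁻¹ := by
    rw [seqNorm_const_smul hp, hsinv]
    refine mul_le_of_le_one_right' (le_trans (seqNorm_mono fun i => ?_) hc)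
    rw [enorm_smul]
    exact mul_le_of_le_one_right' (enorm_le_one_of_norm_le_one (hu i))
  have hs0' : (s : ℝ≥0∞) ≠ 0 := by exact_mod_cast hs0
  have key := enorm_sum_le_zetaNorm hE hp S hf (lt_top_iff_ne_top.mpr hw)
    (hy.trans_lt (ENNReal.inv_lt_top.mpr (pos_iff_ne_zero.mpr hs0')))
    (le_trans (mul_le_mul' hs.le hy) (ENNReal.mul_inv_le_one _))
  have e : ∑ i, f i (S ((s : ℝ)⁻¹ • c i • u i)) = (s : ℝ)⁻¹ * ∑ i, c i * f i (S (u i)) := by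
    simp [Finset.mul_sum]
  rw [e, enorm_mul, hsinv] at key
  have := (ENNReal.inv_mul_le_iff hs0' ENNReal.coe_ne_top).mp (key.trans hC.le)
  rwa [mul_comm]

end LowerBound

/-! ### Parametrizing operators by `ℓ_1`. -/

section SumOperator

variable {ι E F : Type*} [NormedAddCommGroup E] [NormedSpace ℝ E]
  [NormedAddCommGroup F] [NormedSpace ℝ F]

theorem hasSum_clm_apply {f : ι → E →L[ℝ] F} {U : E →L[ℝ] F} (h : HasSum f U) (x : E) :
    HasSum (fun i => f i x) (U x) := by
  have := h.map (ContinuousLinearMap.apply ℝ F x) (ContinuousLinearMap.apply ℝ F x).continuous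
  exact this

theorem hasSum_norm_lp_one (w : lp (fun _ : ι => ℝ) 1) : HasSum (fun i => ‖w i‖) ‖w‖ := by
  simpa using lp.hasSum_norm (p := 1) (by simp) w

/-- Complete `ℓ_1` domains allow the open mapping theorem to be used without proving the nuclear
operator spaces complete. -/
theorem exists_lp_one_sum [CompleteSpace F] (g : ι → F) (B : ℝ) (hg : ∀ i, ‖g i‖ ≤ B) :
    ∃ Q : lp (fun _ : ι => ℝ) 1 →L[ℝ] F, ∀ w, HasSum (fun i => w i • g i) (Q w) := by
  have hle : ∀ (w : lp (fun _ : ι => ℝ) 1) i, ‖w i • g i‖ ≤ ‖w i‖ * B := fun w i => by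
    rw [norm_smul]
    gcongr
    exact hg i
  have hs : ∀ w : lp (fun _ : ι => ℝ) 1, Summable fun i => w i • g i := fun w =>
    Summable.of_norm_bounded ((hasSum_norm_lp_one w).summable.mul_right B) (hle w)
  let L : lp (fun _ : ι => ℝ) 1 →ₗ[ℝ] F :=
    { toFun := fun w => ∑' i, w i • g i
      map_add' := fun w w' => by
        simp only [lp.coeFn_add, Pi.add_apply, add_smul]
        exact (hs w).tsum_add (hs w')
      map_smul' := fun c w => by
        simp only [lp.coeFn_smul, Pi.smul_apply, smul_assoc, RingHom.id_apply]
        exact (hs w).tsum_const_smul c }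
  refine ⟨L.mkContinuous B fun w => ?_, fun w => (hs w).hasSum⟩
  rw [mul_comm]
  exact tsum_of_norm_bounded ((hasSum_norm_lp_one w).mul_right B) (hle w)

theorem lp_one_sum_single [DecidableEq ι] {g : ι → F} {Q : lp (fun _ : ι => ℝ) 1 →L[ℝ] F}
    (hQ : ∀ w, HasSum (fun i => w i • g i) (Q w)) (i : ι) (c : ℝ) :
    Q (lp.single 1 i c) = c • g i := by
  refine (hQ _).unique ?_
  have := hasSum_single (f := fun j => (lp.single (E := fun _ : ι => ℝ) 1 i c) j • g j) i
    fun j hj => by simp [hj]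
  simpa using this

variable (E F) in
/-- Pairs of a functional and a vector in the closed unit balls. -/
abbrev UnitPairs := {φ : StrongDual ℝ E // ‖φ‖ ≤ 1} × {x : F // ‖x‖ ≤ 1}

/-- The rank one operator attached to a pair of a functional and a vector. -/
def UnitPairs.rankOne (γ : UnitPairs E F) : E →L[ℝ] F := (γ.1 : StrongDual ℝ E).smulRight (γ.2 : F)

theorem UnitPairs.norm_rankOne_le (γ : UnitPairs E F) : ‖γ.rankOne‖ ≤ 1 := by
  rw [UnitPairs.rankOne, ContinuousLinearMap.norm_smulRight_apply]
  exact mul_le_one₀ γ.1.2 (norm_nonneg _) γ.2.2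

/-- Every nuclear operator is an absolutely convergent combination of rank one operators given by
pairs of elements of the unit balls. -/
theorem IsNuclear.exists_lp_one_sum_eq {U : E →L[ℝ] F} (hU : IsNuclear U)
    {Q : lp (fun _ : UnitPairs E F => ℝ) 1 →L[ℝ] (E →L[ℝ] F)}
    (hQ : ∀ w, HasSum (fun γ => w γ • UnitPairs.rankOne γ) (Q w)) : ∃ w, Q w = U := by
  classical
  obtain ⟨a, v, ha, hv, hsum⟩ := hU
  have hsa : Summable fun j => ‖a j‖ := by
    rw [seqNorm_one] at ha
    rw [← tsum_enorm_ne_top_iff_summable_norm]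
    exact ha.ne
  obtain ⟨M, hM0, hvM⟩ : ∃ M : ℝ, 0 < M ∧ ∀ j, ‖v j‖ ≤ M := by
    -- Adding `1` keeps `M` positive, so the scaling by `M⁻¹` can be undone.
    refine ⟨(weakSeqNorm ∞ v).toReal + 1, by positivity, fun j => ?_⟩
    have h1 := ENNReal.toReal_mono hv.ne (enorm_le_weakSeqNorm_top v j)
    rw [toReal_enorm] at h1
    linarith
  let γ : ℕ → UnitPairs E F := fun j =>
    (⟨‖a j‖⁻¹ • a j, by
      rw [norm_smul, norm_inv, norm_norm]; exact inv_mul_le_one⟩,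
     ⟨M⁻¹ • v j, by
      rw [norm_smul, norm_inv, Real.norm_of_nonneg hM0.le]
      exact inv_mul_le_one_of_le₀ (hvM j) hM0.le⟩)
  have hs : Summable fun j => lp.single (E := fun _ : UnitPairs E F => ℝ) 1 (γ j) (‖a j‖ * M) := by
    refine Summable.of_norm ?_
    simp only [lp.norm_single (p := 1) zero_lt_one, norm_mul, norm_norm]
    exact hsa.mul_right _
  refine ⟨∑' j, lp.single (E := fun _ : UnitPairs E F => ℝ) 1 (γ j) (‖a j‖ * M),
    ContinuousLinearMap.ext fun x => ?_⟩
  refine HasSum.unique (hasSum_clm_apply (Q.hasSum hs.hasSum) x) ?_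
  convert hsum x using 2 with j
  simp only [lp_one_sum_single hQ, UnitPairs.rankOne,
    smul_apply, ContinuousLinearMap.smulRight_apply, γ, smul_smul, smul_eq_mul]
  by_cases hj : ‖a j‖ = 0
  · simp [norm_eq_zero.mp hj]
  · congr 1
    field_simp

/-- The index type may be uncountable, but `w` has countable support; restricted to it, the defining
sum is a nuclear representation. -/
theorem nuclearNorm_lp_one_sum_le {Q : lp (fun _ : UnitPairs E F => ℝ) 1 →L[ℝ] (E →L[ℝ] F)}
    (hQ : ∀ w, HasSum (fun γ => w γ • UnitPairs.rankOne γ) (Q w))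
    (w : lp (fun _ : UnitPairs E F => ℝ) 1) : nuclearNorm (Q w) ≤ ‖w‖ₑ := by
  have hw := hasSum_norm_lp_one w
  have hc : (Function.support fun γ => w γ).Countable := by
    have := hw.summable.countable_support
    simpa [Function.support] using this
  have : Countable (Function.support fun γ => w γ) := hc
  have h1 : seqNorm 1 (fun i : Function.support fun γ => w γ => w i • (i.1.1 : StrongDual ℝ E)) ≤
      ‖w‖ₑ := by
    rw [seqNorm_one]
    calc _ ≤ ∑' i : Function.support fun γ => w γ, ‖w i‖ₑ := by
          gcongr with i
          rw [enorm_smul]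
          exact mul_le_of_le_one_right' (enorm_le_one_of_norm_le_one i.1.1.2)
      _ ≤ ∑' γ, ‖w γ‖ₑ :=
          ENNReal.tsum_comp_le_tsum_of_injective Subtype.val_injective fun γ => ‖w γ‖ₑ
      _ = ‖w‖ₑ := by
          simp only [← ofReal_norm]
          rw [← ENNReal.ofReal_tsum_of_nonneg (fun _ => norm_nonneg _) hw.summable, hw.tsum_eq]
  have h2 : weakSeqNorm ∞ (fun i : Function.support fun γ => w γ => (i.1.2 : F)) ≤ 1 :=
    weakSeqNorm_top_le fun i => enorm_le_one_of_norm_le_one i.1.2.2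
  have h3 := isNuclear_of_family (U := Q w) (h1.trans_lt enorm_lt_top)
    (h2.trans_lt ENNReal.one_lt_top) fun x => ?_
  · exact h3.2.trans (by simpa using mul_le_mul' h1 h2)
  · have h4 : HasSum (fun γ => (w γ • UnitPairs.rankOne γ) x) (Q w x) :=
      hasSum_clm_apply (hQ w) x
    rw [← hasSum_subtype_iff_of_support_subset (s := Function.support fun γ => w γ)] at h4
    · convert h4 using 2 with i
      simp [UnitPairs.rankOne, smul_smul]
    · intro γ hγ hγ'
      exact hγ (by simp [show w γ = 0 from hγ'])

end SumOperator

/-! ### Finiteness of `ζ^p` by the open mapping theorem. -/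

section Boundedness

variable {E X : Type*} [NormedAddCommGroup E] [NormedSpace ℝ E]
  [NormedAddCommGroup X] [NormedSpace ℝ X] [Lattice X] {p : ℝ≥0∞}

theorem exists_normalized_posNuclearRep (hp : 1 ≤ p) {T : X →L[ℝ] E} (hT : posNuclearNorm p T ≤ 1) :
    ∃ a u, IsPosNuclearRep p T a u ∧ weakSeqNorm p.conjExponent a ≤ 1 ∧ seqNorm p u ≤ 3 := by
  have hT2 : posNuclearNorm p T < 2 := hT.trans_lt (by norm_num)
  simp only [posNuclearNorm, iInf_lt_iff] at hT2
  obtain ⟨a, u, ⟨hpos, ha, hu, hsum⟩, hlt⟩ := hT2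
  obtain ⟨α, hα⟩ : ∃ α : ℝ≥0, weakSeqNorm p.conjExponent a = α :=
    ⟨_, (ENNReal.coe_toNNReal ha.ne).symm⟩
  obtain ⟨β, hβ⟩ : ∃ β : ℝ≥0, seqNorm p u = β := ⟨_, (ENNReal.coe_toNNReal hu.ne).symm⟩
  rw [hα, hβ] at hlt
  have hlt' : α * β < 2 := by exact_mod_cast hlt
  -- `s ≥ α` normalizes the functionals. The term `(β + 1)⁻¹` makes `s` positive even if `α = 0`,
  -- and costs at most `1` in `s * β ≤ 2 + 1`.
  set s : ℝ≥0 := α + (β + 1)⁻¹ with hs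
  have hs0 : 0 < s := by positivity
  have hs0' : (s : ℝ) ≠ 0 := by exact_mod_cast hs0.ne'
  have h1 : weakSeqNorm p.conjExponent (fun j => (s : ℝ)⁻¹ • a j) ≤ 1 := by
    rw [weakSeqNorm_const_smul (one_le_conjExponent hp), hα, enorm_inv hs0']
    have : ‖(s : ℝ)‖ₑ = s := by simp
    rw [this, ← ENNReal.coe_inv hs0.ne']
    have h : s⁻¹ * α ≤ 1 := inv_mul_le_one_of_le₀ (by rw [hs]; exact le_self_add) hs0.le
    exact_mod_cast h
  have h2 : seqNorm p (fun j => (s : ℝ) • u j) ≤ 3 := by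
    rw [seqNorm_const_smul hp, hβ]
    have : ‖(s : ℝ)‖ₑ = s := by simp
    rw [this]
    have h : s * β ≤ 3 := by
      have h3 : (β + 1)⁻¹ * β ≤ 1 := inv_mul_le_one_of_le₀ le_self_add (by positivity)
      calc s * β = α * β + (β + 1)⁻¹ * β := by rw [hs, add_mul]
        _ ≤ 2 + 1 := add_le_add hlt'.le h3
        _ = 3 := by norm_num
    exact_mod_cast h
  refine ⟨_, _, ⟨fun j x hx => ?_, h1.trans_lt ENNReal.one_lt_top, h2.trans_lt (by simp),
    fun x => ?_⟩, h1, h2⟩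
  · simpa using mul_nonneg (inv_nonneg.mpr s.2) (hpos j x hx)
  · convert hsum x using 2 with j
    simp only [smul_apply, smul_smul, smul_eq_mul]
    congr 1
    field_simp

theorem IsPosNuclearRep.norm_le (hp : 1 ≤ p) {T : X →L[ℝ] E} {a : ℕ → StrongDual ℝ X}
    {u : ℕ → E} (h : IsPosNuclearRep p T a u) (ha : weakSeqNorm p.conjExponent a ≤ 1)
    (hu : seqNorm p u ≤ 3) : ‖T‖ ≤ 3 := by
  refine T.opNorm_le_bound (by norm_num) fun x => ?_
  have h1 : ‖T x‖ₑ ≤ ‖x‖ₑ * 1 * 3 := by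
    rw [← (h.2.2.2 x).tsum_eq]
    refine enorm_tsum_le_tsum_enorm.trans ((tsum_enorm_smul_le hp a u x).trans ?_)
    gcongr
  have h2 := ENNReal.toReal_mono (by finiteness) h1
  simp only [mul_one, ENNReal.toReal_mul, toReal_enorm, ENNReal.toReal_ofNat] at h2
  linarith

/-- Absolutely convergent combinations, with geometric weights, of normalized positively
`p`-nuclear operators are positively `p`-nuclear. -/
theorem isPosNuclear_of_hasSum [CompleteSpace E] (hp : 1 ≤ p) {T : ℕ → X →L[ℝ] E}
    {a : ℕ → ℕ → StrongDual ℝ X} {u : ℕ → ℕ → E} (hT : ∀ k, IsPosNuclearRep p (T k) (a k) (u k))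
    (ha : ∀ k, weakSeqNorm p.conjExponent (a k) ≤ 1) (hu : ∀ k, seqNorm p (u k) ≤ 3)
    (c : lp (fun _ : ℕ => ℝ) 1) {V : X →L[ℝ] E}
    (hV : HasSum (fun k => c k • ((1 / 4 : ℝ) ^ k • T k)) V) : IsPosNuclear p V := by
  have hq := one_le_conjExponent hp
  have hgeom : ∑' k : ℕ, ‖(1 / 2 : ℝ) ^ k‖ₑ < ∞ := by
    refine lt_top_iff_ne_top.mpr (tsum_enorm_ne_top_iff_summable_norm.mpr ?_)
    simpa using summable_geometric_two
  -- The weight `4⁻ᵏ` is split as `2⁻ᵏ · 2⁻ᵏ` between functionals and vectors. The coefficient `c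
  -- k`, of arbitrary sign, goes to the vectors so that the functionals stay positive.
  have h1 : weakSeqNorm p.conjExponent (fun x : ℕ × ℕ => (1 / 2 : ℝ) ^ x.1 • a x.1 x.2) < ∞ := by
    refine ((weakSeqNorm_prod_le_tsum hq fun k j => (1 / 2 : ℝ) ^ k • a k j).trans
      (ENNReal.tsum_le_tsum fun k => ?_)).trans_lt hgeom
    rw [weakSeqNorm_const_smul hq]
    exact mul_le_of_le_one_right' (ha k)
  have h2 : seqNorm p (fun x : ℕ × ℕ => (c x.1 * (1 / 2 : ℝ) ^ x.1) • u x.1 x.2) < ∞ := by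
    have hc : ∑' k, ‖c k‖ₑ * 3 < ∞ := by
      rw [ENNReal.tsum_mul_right]
      refine ENNReal.mul_lt_top (lt_top_iff_ne_top.mpr ?_) (by simp)
      exact tsum_enorm_ne_top_iff_summable_norm.mpr (hasSum_norm_lp_one c).summable
    refine ((seqNorm_prod_le_tsum hp fun k j => (c k * (1 / 2 : ℝ) ^ k) • u k j).trans
      (ENNReal.tsum_le_tsum fun k => ?_)).trans_lt hc
    rw [seqNorm_const_smul hp]
    gcongr
    · rw [enorm_mul]
      refine mul_le_of_le_one_right' (enorm_le_one_of_norm_le_one ?_)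
      rw [norm_pow]
      exact pow_le_one₀ (norm_nonneg _) (by norm_num)
    · exact hu k
  refine (isPosNuclear_of_family (T := V) hp (fun i x hx => ?_) h1 h2 fun x => ?_).1
  · change 0 ≤ (1 / 2 : ℝ) ^ i.1 * a i.1 i.2 x
    exact mul_nonneg (by positivity) ((hT i.1).1 i.2 x hx)
  -- Hölder gives absolute convergence of the double series, which permits summing it row by row.
  · have hs : Summable fun i : ℕ × ℕ => ((1 / 2 : ℝ) ^ i.1 • a i.1 i.2) x •
        (c i.1 * (1 / 2 : ℝ) ^ i.1) • u i.1 i.2 := by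
      refine Summable.of_norm (tsum_enorm_ne_top_iff_summable_norm.mp
        ((tsum_enorm_smul_le hp _ _ x).trans_lt ?_).ne)
      exact ENNReal.mul_lt_top (ENNReal.mul_lt_top enorm_lt_top h1) h2
    have h3 : ∀ k, HasSum (fun j => ((1 / 2 : ℝ) ^ k • a k j) x •
        (c k * (1 / 2 : ℝ) ^ k) • u k j) ((c k • ((1 / 4 : ℝ) ^ k • T k)) x) := by
      intro k
      have h4 := ((hT k).2.2.2 x).const_smul (c k * (1 / 4 : ℝ) ^ k)
      have e : (1 / 4 : ℝ) ^ k = (1 / 2 : ℝ) ^ k * (1 / 2 : ℝ) ^ k := by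
        rw [← mul_pow]; norm_num
      convert h4 using 2 with j
      · simp only [smul_apply, smul_smul, smul_eq_mul]
        congr 1
        rw [e]
        ring
      · simp only [smul_apply, smul_smul]
    have h5 := hs.hasSum.prod_fiberwise h3
    have h6 : HasSum (fun k => (c k • ((1 / 4 : ℝ) ^ k • T k)) x) (V x) :=
      hasSum_clm_apply hV x
    rw [← h5.unique h6]
    exact hs.hasSum

/-- Were `ζ^p(S)` infinite, there would be normalized `T k` with `ν(T k S) > k 4ᵏ`. All `Φ c = ∑ c_k
4⁻ᵏ T_k` with `c ∈ ℓ_1` are positively `p`-nuclear, so `Φ c ∘ S` is nuclear and equals some `Q w`.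
Open mapping bounds `‖w‖` by `C ‖c‖` for a suitable `w`; the unit vectors `c = e_k` with `k ≥ C`
contradict the choice of `T k`. -/
theorem zetaNorm_lt_top [CompleteSpace E] (hp : 1 ≤ p) {S : E →L[ℝ] X} (hS : S ∈ UStar E X p) :
    zetaNorm p S < ∞ := by
  classical
  by_contra hcon
  have htop : zetaNorm p S = ∞ := not_lt_top_iff.mp hcon
  have hex : ∀ k : ℕ, ∃ T : X →L[ℝ] E, posNuclearNorm p T ≤ 1 ∧
      (k * 4 ^ k : ℝ≥0∞) < nuclearNorm (T ∘L S) := by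
    intro k
    have : (k * 4 ^ k : ℝ≥0∞) < zetaNorm p S := by
      rw [htop]
      exact lt_top_iff_ne_top.mpr (by finiteness)
    simp only [zetaNorm, lt_iSup_iff] at this
    obtain ⟨T, hT, h⟩ := this
    exact ⟨T, hT.2, h⟩
  choose T hT1 hT2 using hex
  choose a u hrep ha hu using fun k => exists_normalized_posNuclearRep hp (hT1 k)
  obtain ⟨Φ, hΦ⟩ := exists_lp_one_sum (fun k => (1 / 4 : ℝ) ^ k • T k) 3 fun k => by
    rw [norm_smul, norm_pow]
    have h1 := (hrep k).norm_le hp (ha k) (hu k)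
    have h2 : ‖(1 / 4 : ℝ)‖ ^ k ≤ 1 := pow_le_one₀ (norm_nonneg _) (by norm_num)
    nlinarith [norm_nonneg (T k)]
  obtain ⟨Q, hQ⟩ := exists_lp_one_sum (fun γ : UnitPairs E E => γ.rankOne) 1
    UnitPairs.norm_rankOne_le
  let Ψ : lp (fun _ : ℕ => ℝ) 1 →L[ℝ] (E →L[ℝ] E) :=
    ((ContinuousLinearMap.compL ℝ E X E).flip S) ∘L Φ
  have hΨ : ∀ c, Ψ c = Φ c ∘L S := fun c => rfl
  let D : lp (fun _ : ℕ => ℝ) 1 × lp (fun _ : UnitPairs E E => ℝ) 1 →L[ℝ] (E →L[ℝ] E) :=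
    Ψ ∘L ContinuousLinearMap.fst ℝ _ _ - Q ∘L ContinuousLinearMap.snd ℝ _ _
  have hD : ∀ z, D z = Ψ z.1 - Q z.2 := fun z => rfl
  -- `Z` is the fibre product of `Ψ` and `Q`; being closed, it is a Banach space, and its projection
  -- to `c` is onto because `S ∈ UStar`.
  let Z := LinearMap.ker D.toLinearMap
  have hZc : IsClosed (Z : Set (lp (fun _ : ℕ => ℝ) 1 × lp (fun _ : UnitPairs E E => ℝ) 1)) :=
    D.isClosed_ker
  have : CompleteSpace Z := hZc.completeSpace_coe
  let π : Z →L[ℝ] lp (fun _ : ℕ => ℝ) 1 := ContinuousLinearMap.fst ℝ _ _ ∘L Z.subtypeL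
  have hπ : Function.Surjective π := by
    intro c
    obtain ⟨w, hw⟩ := (hS _ (isPosNuclear_of_hasSum hp hrep ha hu c (hΦ c))).exists_lp_one_sum_eq hQ
    refine ⟨⟨(c, w), ?_⟩, rfl⟩
    change D (c, w) = 0
    rw [hD, hΨ, hw, sub_self]
  obtain ⟨C, -, hC⟩ := π.exists_preimage_norm_le hπ
  obtain ⟨k, hk⟩ := exists_nat_ge C
  obtain ⟨z, hz, hzn⟩ := hC (lp.single 1 k 1)
  rw [lp.norm_single (p := 1) zero_lt_one, norm_one, mul_one] at hzn
  have h1 : Q z.1.2 = (1 / 4 : ℝ) ^ k • (T k ∘L S) := by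
    have h2 : D z.1 = 0 := z.2
    rw [hD, sub_eq_zero] at h2
    rw [← h2, show z.1.1 = lp.single 1 k 1 from hz, hΨ, lp_one_sum_single hΦ, one_smul]
    rfl
  have h3 : Q ((4 : ℝ) ^ k • z.1.2) = T k ∘L S := by
    rw [map_smul, h1, smul_smul, ← mul_pow]
    norm_num
  have h4 := nuclearNorm_lp_one_sum_le hQ ((4 : ℝ) ^ k • z.1.2)
  rw [h3] at h4
  refine absurd ((hT2 k).trans_le h4) (not_lt.mpr ?_)
  have h5 : ‖z.1.2‖ ≤ k := (norm_snd_le z.1).trans (hzn.trans hk)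
  rw [enorm_smul, mul_comm]
  have h6 : ‖z.1.2‖ₑ ≤ k := by
    rw [← ofReal_norm, ← ENNReal.ofReal_natCast]
    exact ENNReal.ofReal_le_ofReal h5
  have h7 : ‖(4 : ℝ) ^ k‖ₑ = 4 ^ k := by
    rw [enorm_pow, Real.enorm_of_nonneg (by norm_num)]
    norm_num
  rw [h7]
  gcongr

end Boundedness

end PosMajorizing

end

theorem mainTheorem11
    {E : Type*} [NormedAddCommGroup E] [NormedSpace ℝ E] [CompleteSpace E]
    (hE : PosMajorizing.HasAP E)
    {X : Type*} [NormedAddCommGroup X] [NormedSpace ℝ X] [CompleteSpace X]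
    [Lattice X] [IsOrderedAddMonoid X] [IsOrderedModule ℝ X] [HasSolidNorm X]
    (p : ENNReal) (hp : 1 ≤ p) :
    PosMajorizing.Upsilon E X p.conjExponent = PosMajorizing.UStar E X p ∧
    ∀ S ∈ PosMajorizing.UStar E X p,
      PosMajorizing.upsilonNorm p.conjExponent S = PosMajorizing.zetaNorm p S := by
  refine ⟨Set.Subset.antisymm ?_ fun S hS => ?_, fun S hS => le_antisymm ?_ ?_⟩
  · rintro S ⟨C, -, h⟩ T ⟨a, u, hT⟩
    exact (h.nuclear_comp hp hT).1
  · obtain ⟨C, hC, -⟩ := ENNReal.lt_iff_exists_nnreal_btwn.mp (PosMajorizing.zetaNorm_lt_top hp hS)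
    exact ⟨C, ENNReal.coe_pos.mp (bot_le.trans_lt hC),
      PosMajorizing.isMajorizingBound_of_zetaNorm_lt hE hp hC⟩
  -- Every finite `C > ζ^p(S)` is an admissible majorizing constant.
  · refine le_of_forall_gt fun b hb => ?_
    obtain ⟨C, hC, hCb⟩ := ENNReal.lt_iff_exists_nnreal_btwn.mp hb
    exact (iInf₂_le C ⟨ENNReal.coe_pos.mp (bot_le.trans_lt hC),
      PosMajorizing.isMajorizingBound_of_zetaNorm_lt hE hp hC⟩).trans_lt hCb
  · refine le_iInf₂ fun C hC => iSup₂_le fun T hT => ?_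
    exact (hC.2.nuclearNorm_comp_le hp hC.1 T).trans (mul_le_of_le_one_right' hT.2)
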